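/- Let $X$ be a connected (Hausdorff, second countable, finite-dimensional) complex manifold. The Kobayashi pseudodistance $\mathsf{k}_X(x,y)$ is the infimum of $\sum_{j=1}^n \rho(a_j,b_j)$ over all finite chains of holomorphic maps $f_1,\dots,f_n:\mathbb{D}\to X$ and points $a_j,b_j$ of the unit disc $\mathbb{D}$ with $f_1(a_1)=x$, $f_j(b_j)=f_{j+1}(a_{j+1})$ for $1\le j<n$, and $f_n(b_n)=y$, where $\rho(z,w)=\tanh^{-1}\left|\frac{z-w}{1-\overline{w}z}\right|$ is the Poincaré distance. Suppose that $X$ is Kobayashi hyperbolic, i.e. $\mathsf{k}_X(x,y)=0$ only if $x=y$; no completeness of $\mathsf{k}_X$ is assumed. Let $C(X)$ be the space of real-valued continuous functions on the metric space $(X,\mathsf{k}_X)$ with the topology of locally uniform convergence, let $C_*(X)$ be its quotient by the subspace of constant functions, with the quotient topology, and let $i_{\mathsf{k}}:X\to C_*(X)$, $i_{\mathsf{k}}(x)=[\mathsf{k}_X(x,\cdot)]$. Let $\overline{X}^{\mathsf{k}}$, the metric (horofunction) compactification, be the closure of $i_{\mathsf{k}}(X)$ in $C_*(X)$, with the subspace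 topology. Then the topology of $(X,\mathsf{k}_X)$ is the manifold topology of $X$, and $(\overline{X}^{\mathsf{k}}, i_{\mathsf{k}})$ is a compactification of $X$: the space $\overline{X}^{\mathsf{k}}$ is sequentially compact and Hausdorff, $i_{\mathsf{k}}:X\to\overline{X}^{\mathsf{k}}$ is a homeomorphism onto its image, and $i_{\mathsf{k}}(X)$ is open and dense in $\overline{X}^{\mathsf{k}}$. -/

import Mathlib

open Set Topology
open scoped Manifold ContDiff ENNReal ComplexConjugate

/-! ### Compactifications -/

/-- A map `ι : X → Y` exhibits `Y` as a compactification of `X`: the space `Y` is sequentially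
compact and Hausdorff, and `ι` is a homeomorphism onto its image, which is open and dense. -/
structure IsCompactification {X Y : Type*} [TopologicalSpace X] [TopologicalSpace Y]
    (ι : X → Y) : Prop where
  seqCompact : SeqCompactSpace Y
  hausdorff : T2Space Y
  isEmbedding : IsEmbedding ι
  isOpen_range : IsOpen (range ι)
  dense_range : Dense (range ι)

/-! ### The metric compactification of a metric space -/

/-- The subspace of constant functions in `C(X)`. -/
def constFunctions (X : Type*) [TopologicalSpace X] : Submodule ℝ C(X, ℝ) where
  carrier := {f | ∃ c : ℝ, f = ContinuousMap.const X c}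
  add_mem' := by
    rintro _ _ ⟨c, rfl⟩ ⟨d, rfl⟩
    exact ⟨c + d, rfl⟩
  zero_mem' := ⟨0, rfl⟩
  smul_mem' := by
    rintro r _ ⟨c, rfl⟩
    exact ⟨r * c, rfl⟩

/-- `C_*(X)`: continuous functions modulo constants, with the quotient topology. Mathlib's
topology on `C(X, ℝ)` is the compact-open topology, which on a locally compact space is the
topology of locally uniform convergence. -/
abbrev FunctionsModConst (X : Type*) [TopologicalSpace X] : Type _ :=
  C(X, ℝ) ⧸ constFunctions X

/-- The function `d_x = d(x, ·)`. -/
def distFrom {X : Type*} [MetricSpace X] (x : X) : C(X, ℝ) where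
  toFun z := dist x z
  continuous_toFun := continuous_const.dist continuous_id

/-- The map `i_d : X → C_*(X)`, `x ↦ [d(x, ·)]`. -/
def distClass {X : Type*} [MetricSpace X] (x : X) : FunctionsModConst X :=
  (constFunctions X).mkQ (distFrom x)

/-- The metric (horofunction) compactification: the closure of `i_d(X)` in `C_*(X)`, with the
subspace topology. -/
abbrev MetricCompactification (X : Type*) [MetricSpace X] : Type _ :=
  closure (range (distClass : X → FunctionsModConst X))

/-- The canonical map of a metric space into its metric compactification. -/
def toMetricCompactification {X : Type*} [MetricSpace X] (x : X) : MetricCompactification X :=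
  ⟨distClass x, subset_closure (mem_range_self x)⟩

/-! ### The Kobayashi distance -/

/-- The Poincaré distance of the open unit disc,
`ρ(z, w) = artanh |(z - w) / (1 - conj w * z)|`. -/
noncomputable def poincareDist (z w : ℂ) : ℝ :=
  Real.artanh ‖(z - w) / (1 - conj w * z)‖

/-- `f` restricts to a holomorphic map from the open unit disc to `X`, where `X` is a complex
manifold modelled on `E`. Values of `f` off the disc are irrelevant. -/
def IsHolomorphicDisc (E : Type*) [NormedAddCommGroup E] [NormedSpace ℂ E] {X : Type*}
    [TopologicalSpace X] [ChartedSpace E X] (f : ℂ → X) : Prop :=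
  MDifferentiableOn 𝓘(ℂ, ℂ) 𝓘(ℂ, E) f (Metric.ball 0 1)

/-- `DiscChain E x y L`: there is a finite chain of holomorphic discs from `x` to `y` of total
Poincaré length `L`, that is, there are holomorphic discs `f₁, …, fₙ` and points `aⱼ, bⱼ` of the
unit disc with `f₁ a₁ = x`, `fⱼ bⱼ = fⱼ₊₁ aⱼ₊₁`, `fₙ bₙ = y` and `L = ∑ ρ(aⱼ, bⱼ)`. -/
inductive DiscChain (E : Type*) [NormedAddCommGroup E] [NormedSpace ℂ E] {X : Type*}
    [TopologicalSpace X] [ChartedSpace E X] : X → X → ℝ → Prop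
  | nil (x : X) : DiscChain E x x 0
  | cons {f : ℂ → X} {a b : ℂ} {y : X} {L : ℝ} (hf : IsHolomorphicDisc E f)
      (ha : a ∈ Metric.ball (0 : ℂ) 1) (hb : b ∈ Metric.ball (0 : ℂ) 1)
      (h : DiscChain E (f b) y L) : DiscChain E (f a) y (poincareDist a b + L)

/-- The Kobayashi pseudodistance: the infimum of the lengths of chains of holomorphic discs
joining the two points (`∞` if there are none). -/
noncomputable def kobayashiEDist (E : Type*) [NormedAddCommGroup E] [NormedSpace ℂ E] {X : Type*}
    [TopologicalSpace X] [ChartedSpace E X] (x y : X) : ℝ≥0∞ :=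
  ⨅ (L : ℝ) (_ : DiscChain E x y L), ENNReal.ofReal L

/-- Kobayashi hyperbolicity: the Kobayashi pseudodistance separates points. -/
class KobayashiHyperbolic (E : Type*) [NormedAddCommGroup E] [NormedSpace ℂ E] (X : Type*)
    [TopologicalSpace X] [ChartedSpace E X] : Prop where
  eq_of_kobayashiEDist_eq_zero : ∀ x y : X, kobayashiEDist E x y = 0 → x = y

section KobayashiFacts

variable {E : Type*} [NormedAddCommGroup E] [NormedSpace ℂ E] {X : Type*}
  [TopologicalSpace X] [ChartedSpace E X]

theorem poincareDist_comm (z w : ℂ) : poincareDist z w = poincareDist w z := by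
  have h : ‖1 - conj w * z‖ = ‖1 - conj z * w‖ := by
    rw [← Complex.norm_conj (1 - conj w * z)]
    simp [mul_comm]
  simp only [poincareDist, norm_div, h, norm_sub_rev z w]

theorem DiscChain.append {x y z : X} {L L' : ℝ} (h : DiscChain E x y L)
    (h' : DiscChain E y z L') : DiscChain E x z (L + L') := by
  induction h with
  | nil => simpa using h'
  | cons hf ha hb _ ih =>
    rw [add_assoc]
    exact DiscChain.cons hf ha hb (ih h')

theorem DiscChain.reverse {x y : X} {L : ℝ} (h : DiscChain E x y L) : DiscChain E y x L := by
  induction h with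
  | nil x => exact DiscChain.nil x
  | @cons f a b y L hf ha hb _ ih =>
    have h1 : DiscChain E (f b) (f a) (poincareDist a b) := by
      simpa [poincareDist_comm b a] using DiscChain.cons hf hb ha (DiscChain.nil (f a))
    rw [add_comm]
    exact ih.append h1

theorem kobayashiEDist_self (x : X) : kobayashiEDist E x x = 0 := by
  refine le_antisymm (iInf₂_le_of_le 0 (DiscChain.nil x) ?_) zero_le
  simp

theorem kobayashiEDist_comm (x y : X) : kobayashiEDist E x y = kobayashiEDist E y x :=
  le_antisymm (le_iInf₂ fun L h => iInf₂_le L h.reverse)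
    (le_iInf₂ fun L h => iInf₂_le L h.reverse)

theorem kobayashiEDist_triangle (x y z : X) :
    kobayashiEDist E x z ≤ kobayashiEDist E x y + kobayashiEDist E y z := by
  unfold kobayashiEDist
  simp only [ENNReal.iInf_add, ENNReal.add_iInf]
  refine le_iInf₂ fun L h => le_iInf₂ fun L' h' => ?_
  exact (iInf₂_le _ (DiscChain.append (by assumption) (by assumption))).trans
    ENNReal.ofReal_add_le

theorem exists_discChain_eventually [IsManifold 𝓘(ℂ, E) ω X] (x : X) :
    ∀ᶠ y in 𝓝 x, ∃ L, DiscChain E x y L := by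
  set φ := chartAt E x with hφ
  obtain ⟨r, hr, hball⟩ := Metric.isOpen_iff.1 φ.open_target (φ x)
    (φ.map_source (mem_chart_source E x))
  have hnear : ∀ᶠ y in 𝓝 x, φ y ∈ Metric.ball (φ x) (r / 2) :=
    (φ.continuousAt (mem_chart_source E x)).eventually (Metric.ball_mem_nhds _ (by positivity))
  filter_upwards [hnear, chart_source_mem_nhds E x] with y hy hys
  set v : E := φ y - φ x with hv
  have hvr : ‖v‖ < r / 2 := by simpa [hv, dist_eq_norm] using hy
  set g : ℂ → E := fun ζ => φ x + (2 * ζ) • v with hg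
  have hmaps : MapsTo g (Metric.ball 0 1) φ.target := by
    intro ζ hζ
    apply hball
    have hζ' : ‖ζ‖ < 1 := by simpa using hζ
    have : 2 * ‖ζ‖ * ‖v‖ < r := by nlinarith [norm_nonneg ζ, norm_nonneg v]
    simpa [hg, dist_eq_norm, norm_smul] using this
  have hgd : MDifferentiableOn 𝓘(ℂ, ℂ) 𝓘(ℂ, E) g (Metric.ball 0 1) := by
    have : Differentiable ℂ g := by simp only [hg]; fun_prop
    exact this.mdifferentiable.mdifferentiableOn
  have hsymm : MDifferentiableOn 𝓘(ℂ, E) 𝓘(ℂ, E) φ.symm φ.target :=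
    (contMDiffOn_chart_symm (I := 𝓘(ℂ, E)) (n := ω) (x := x)).mdifferentiableOn (by simp)
  have hdisc : IsHolomorphicDisc E (φ.symm ∘ g) := hsymm.comp hgd hmaps
  have h0 : (φ.symm ∘ g) 0 = x := by
    simp [hg, φ.left_inv (mem_chart_source E x)]
  have h1 : (φ.symm ∘ g) (1 / 2) = y := by
    simp [hg, hv, φ.left_inv hys]
  have hchain := DiscChain.cons (a := 0) (b := 1 / 2) hdisc (by simp) (by simp; norm_num)
    (DiscChain.nil _)
  rw [h0, h1] at hchain
  exact ⟨_, hchain⟩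

theorem exists_discChain [IsManifold 𝓘(ℂ, E) ω X] [ConnectedSpace X] (x y : X) :
    ∃ L, DiscChain E x y L :=
  PreconnectedSpace.induction₂' (fun x y : X => ∃ L, DiscChain E x y L)
    (fun z => (exists_discChain_eventually z).mono fun _ ⟨L, h⟩ => ⟨⟨L, h⟩, ⟨L, h.reverse⟩⟩)
    ⟨fun _ _ _ ⟨_, h⟩ ⟨_, h'⟩ => ⟨_, h.append h'⟩⟩ x y

theorem kobayashiEDist_ne_top [IsManifold 𝓘(ℂ, E) ω X] [ConnectedSpace X] (x y : X) :
    kobayashiEDist E x y ≠ ⊤ := by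
  obtain ⟨L, h⟩ := exists_discChain (E := E) x y
  exact ne_top_of_le_ne_top ENNReal.ofReal_ne_top (iInf₂_le L h)

end KobayashiFacts

/-- The set `X`, regarded as a metric space through the Kobayashi distance only (the manifold
topology is not used for its topology). -/
def KobayashiSpace (E : Type*) (X : Type*) [NormedAddCommGroup E] [NormedSpace ℂ E]
    [TopologicalSpace X] [ChartedSpace E X] : Type _ := X

/-- The identity map from the manifold `X` to the metric space `(X, k_X)`. -/
def toKobayashiSpace (E : Type*) {X : Type*} [NormedAddCommGroup E] [NormedSpace ℂ E]
    [TopologicalSpace X] [ChartedSpace E X] (x : X) : KobayashiSpace E X := x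

/-- The Kobayashi distance of a connected Kobayashi hyperbolic complex manifold; its topology is
the one defined by the distance. -/
noncomputable instance KobayashiSpace.instMetricSpace {E : Type*} {X : Type*} [NormedAddCommGroup E] [NormedSpace ℂ E]
    [TopologicalSpace X] [ChartedSpace E X] [IsManifold 𝓘(ℂ, E) ω X] [ConnectedSpace X]
    [KobayashiHyperbolic E X] : MetricSpace (KobayashiSpace E X) where
  dist x y := (kobayashiEDist E (X := X) x y).toReal
  dist_self x := by simp [kobayashiEDist_self (E := E) (X := X) x]
  dist_comm x y := by rw [kobayashiEDist_comm (E := E) (X := X) x y]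
  dist_triangle x y z := by
    rw [← ENNReal.toReal_add (kobayashiEDist_ne_top (E := E) (X := X) x y)
      (kobayashiEDist_ne_top (E := E) (X := X) y z)]
    exact ENNReal.toReal_mono (ENNReal.add_ne_top.2
      ⟨kobayashiEDist_ne_top (E := E) (X := X) x y, kobayashiEDist_ne_top (E := E) (X := X) y z⟩)
      (kobayashiEDist_triangle (E := E) (X := X) x y z)
  eq_of_dist_eq_zero := by
    intro x y h
    refine KobayashiHyperbolic.eq_of_kobayashiEDist_eq_zero (E := E) (X := X) x y ?_
    exact ((ENNReal.toReal_eq_zero_iff _).1 h).resolve_right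
      (kobayashiEDist_ne_top (E := E) (X := X) x y)

/-! ### The metric compactification of a locally compact length-like space -/

section MetricCompactification

variable {M : Type*}

/-! Compactness is Arzelà–Ascoli: normalized to vanish at a base point, the functions `d(y, ·)` are
`1`-Lipschitz, hence lie in a compact set whose image in the Hausdorff quotient is closed.

The embedding and the openness of its image need no properness, only small compact balls and points
at prescribed distance nearly on a geodesic (`HasApproxIntermediatePoints`). If the sphere of radius
`r` about `x` is compact, "`h - h x` is positive on the sphere" is an open condition on classes
`[h]`. It holds for `[d(x, ·)]` and fails for `[d(y, ·)]` once `d(x, y) ≥ r`, because an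
almost-geodesic from `x` to `y` crosses the sphere at a point closer to `y` than `x` is
(`exists_isOpen_distClass`).

For the Kobayashi distance, replacing each link of a disc chain by a Poincaré geodesic gives a
connected set, each of whose points splits the chain without changing its length
(`DiscChain.exists_isPreconnected`). The intermediate value theorem on this set yields the
intermediate points. The same set must cross the frontier of any neighbourhood that it leaves, which
shows that the distance induces the manifold topology. -/

theorem IsPreconnected.inter_frontier_nonempty_of_isOpen [TopologicalSpace M] {S V : Set M}
    (hS : IsPreconnected S) (hV : IsOpen V) {x y : M} (hxS : x ∈ S) (hxV : x ∈ V) (hyS : y ∈ S)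
    (hyV : y ∉ V) : (S ∩ frontier V).Nonempty := by
  by_contra hne
  have hcover : S ⊆ V ∪ (closure V)ᶜ := by
    intro p hp
    by_cases hpV : p ∈ V
    · exact Or.inl hpV
    · refine Or.inr fun hpc => hne ⟨p, hp, ?_⟩
      rw [hV.frontier_eq]
      exact ⟨hpc, hpV⟩
  have hyc : y ∈ (closure V)ᶜ := (hcover hyS).resolve_left hyV
  obtain ⟨p, -, hpV, hpc⟩ := hS V _ hV isClosed_closure.isOpen_compl hcover ⟨x, hxS, hxV⟩
    ⟨y, hyS, hyc⟩
  exact hpc (subset_closure hpV)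

/-- The linear map `h ↦ h - h x` on continuous functions. -/
def normalizeAt [TopologicalSpace M] (x : M) : C(M, ℝ) →ₗ[ℝ] C(M, ℝ) where
  toFun h := h - ContinuousMap.const M (h x)
  map_add' f g := by ext z; simp; ring
  map_smul' c f := by ext z; simp; ring

theorem continuous_normalizeAt [TopologicalSpace M] (x : M) : Continuous (normalizeAt x) :=
  continuous_id.sub (ContinuousMap.continuous_const'.comp (continuous_eval_const x))

/-- The linear map on functions modulo constants sending a class to its representative that
vanishes at `x`. -/
def representativeAt [TopologicalSpace M] (x : M) : FunctionsModConst M →ₗ[ℝ] C(M, ℝ) :=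
  (constFunctions M).liftQ (normalizeAt x) (by
    rintro _ ⟨c, rfl⟩
    ext z
    simp [normalizeAt])

theorem representativeAt_mkQ [TopologicalSpace M] (x : M) (h : C(M, ℝ)) :
    representativeAt x ((constFunctions M).mkQ h) = normalizeAt x h := rfl

/-- Conditions on normalized representatives thereby become open conditions on classes. -/
theorem continuous_representativeAt [TopologicalSpace M] (x : M) :
    Continuous (representativeAt x) :=
  (constFunctions M).isOpenQuotientMap_mkQ.continuous_comp_iff.1 (continuous_normalizeAt x)

theorem mkQ_normalizeAt [TopologicalSpace M] (x : M) (h : C(M, ℝ)) :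
    (constFunctions M).mkQ (normalizeAt x h) = (constFunctions M).mkQ h := by
  refine (Submodule.Quotient.eq _).2 ⟨-h x, ?_⟩
  ext z
  simp [normalizeAt]

theorem injective_representativeAt [TopologicalSpace M] (x : M) :
    Function.Injective (representativeAt x) := by
  intro ξ η h
  obtain ⟨f, rfl⟩ := (constFunctions M).mkQ_surjective ξ
  obtain ⟨g, rfl⟩ := (constFunctions M).mkQ_surjective η
  rw [representativeAt_mkQ, representativeAt_mkQ] at h
  rw [← mkQ_normalizeAt x f, h, mkQ_normalizeAt]

theorem t2Space_functionsModConst [TopologicalSpace M] [Nonempty M] :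
    T2Space (FunctionsModConst M) :=
  let ⟨x⟩ := ‹Nonempty M›
  .of_injective_continuous (injective_representativeAt x) (continuous_representativeAt x)

/-! ### Distance functions modulo constants -/

variable [MetricSpace M]

theorem representativeAt_distClass (x y z : M) :
    representativeAt x (distClass y) z = dist y z - dist y x := rfl

/-- The `1`-Lipschitz functions vanishing at `x`. -/
def lipschitzVanishingAt (x : M) : Set C(M, ℝ) :=
  {f | f x = 0 ∧ LipschitzWith 1 f}

/-- Pointwise, these functions form a closed subset of the product of the intervals `[-d(z, x), d(z,
x)]`; equicontinuity upgrades this to compactness in the compact-open topology. -/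
theorem isCompact_lipschitzVanishingAt (x : M) : IsCompact (lipschitzVanishingAt x) := by
  apply ArzelaAscoli.isCompact_of_equicontinuous
  · have himage : ContinuousMap.toFun '' lipschitzVanishingAt x =
        {f : M → ℝ | f x = 0 ∧ LipschitzWith 1 f} := by
      ext f
      constructor
      · rintro ⟨g, hg, rfl⟩
        exact hg
      · rintro ⟨h0, hf⟩
        exact ⟨⟨f, hf.continuous⟩, ⟨h0, hf⟩, rfl⟩
    rw [himage]
    refine IsCompact.of_isClosed_subset
      (isCompact_univ_pi fun z : M => isCompact_Icc (a := -dist z x) (b := dist z x)) ?_ ?_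
    · simp only [lipschitzWith_iff_dist_le_mul, ofPred_and, ofPred_forall]
      refine (isClosed_eq (continuous_apply x) continuous_const).inter ?_
      refine isClosed_iInter fun z => isClosed_iInter fun w => ?_
      exact isClosed_le ((continuous_apply z).dist (continuous_apply w)) continuous_const
    · rintro f ⟨h0, hf⟩ z -
      have := hf.dist_le_mul z x
      rw [h0, Real.dist_eq, sub_zero, NNReal.coe_one, one_mul] at this
      exact abs_le.1 this
  · refine LipschitzWith.uniformEquicontinuous _ 1 (fun f => f.2.2) |>.equicontinuous

theorem distClass_mem_image_lipschitzVanishingAt (x y : M) :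
    distClass y ∈ (constFunctions M).mkQ '' lipschitzVanishingAt x := by
  refine ⟨normalizeAt x (distFrom y), ⟨?_, ?_⟩, mkQ_normalizeAt x _⟩
  · simp [normalizeAt]
  · refine LipschitzWith.of_dist_le_mul fun z w => ?_
    have : dist (normalizeAt x (distFrom y) z) (normalizeAt x (distFrom y) w) =
        dist (dist y z) (dist y w) := by
      simp [normalizeAt, distFrom]
    rw [this, NNReal.coe_one, one_mul, Real.dist_eq, dist_comm y z, dist_comm y w]
    exact abs_dist_sub_le z w y

theorem closure_range_distClass_subset (x : M) :
    closure (range (distClass : M → FunctionsModConst M)) ⊆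
      (constFunctions M).mkQ '' lipschitzVanishingAt x := by
  have : Nonempty M := ⟨x⟩
  have := t2Space_functionsModConst (M := M)
  refine closure_minimal ?_ (((isCompact_lipschitzVanishingAt x).image
    (constFunctions M).isOpenQuotientMap_mkQ.continuous).isClosed)
  rintro _ ⟨y, rfl⟩
  exact distClass_mem_image_lipschitzVanishingAt x y

theorem seqCompactSpace_metricCompactification [LocallyCompactSpace M] [SigmaCompactSpace M]
    [Nonempty M] : SeqCompactSpace (MetricCompactification M) := by
  obtain ⟨x⟩ := ‹Nonempty M›
  -- Subsequences are extracted upstairs in `C(M, ℝ)`, which is first countable since `M` is locally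
  -- compact and σ-compact, and then pushed down.
  have hseq : IsSeqCompact ((constFunctions M).mkQ '' lipschitzVanishingAt x) :=
    (isCompact_lipschitzVanishingAt x).isSeqCompact.image
      (constFunctions M).isOpenQuotientMap_mkQ.continuous.seqContinuous
  refine isSeqCompact_iff_seqCompactSpace.1 fun u hu => ?_
  obtain ⟨a, -, φ, hφ, hlim⟩ := hseq fun n => closure_range_distClass_subset x (hu n)
  exact ⟨a, isClosed_closure.mem_of_tendsto hlim (.of_forall fun n => hu _), φ, hφ, hlim⟩

theorem continuous_distClass : Continuous (distClass : M → FunctionsModConst M) := by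
  refine (constFunctions M).isOpenQuotientMap_mkQ.continuous.comp ?_
  exact ContinuousMap.continuous_of_continuous_uncurry _ continuous_dist

theorem injective_distClass : Function.Injective (distClass : M → FunctionsModConst M) := by
  intro x y h
  -- At `y` the two representatives take the values `d(x, y)` and `-d(x, y)`.
  have := DFunLike.congr_fun (congrArg (representativeAt x) h) y
  rw [representativeAt_distClass, representativeAt_distClass, dist_self, dist_self,
    dist_comm y x] at this
  exact dist_eq_zero.1 (by linarith)

/-- Between any two points there are points at every intermediate distance from the first that are
almost on a geodesic, up to an arbitrarily small error. -/
def HasApproxIntermediatePoints (M : Type*) [MetricSpace M] : Prop :=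
  ∀ (x y : M) (r ε : ℝ), 0 ≤ r → r ≤ dist x y → 0 < ε →
    ∃ z, dist x z = r ∧ dist x z + dist z y ≤ dist x y + ε

/-- `U` consists of the classes whose representative vanishing at `x` is positive on the compact
sphere of radius `r`. -/
theorem HasApproxIntermediatePoints.exists_isOpen_distClass (hM : HasApproxIntermediatePoints M)
    (x : M) {r : ℝ} (hr : 0 < r) (hc : IsCompact (Metric.closedBall x r)) :
    ∃ U : Set (FunctionsModConst M), IsOpen U ∧ distClass x ∈ U ∧
      ∀ y, distClass y ∈ U → dist x y < r := by
  have hsphere : IsCompact (Metric.sphere x r) :=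
    hc.of_isClosed_subset Metric.isClosed_sphere Metric.sphere_subset_closedBall
  refine ⟨representativeAt x ⁻¹' {f | MapsTo f (Metric.sphere x r) (Ioi 0)},
    (ContinuousMap.isOpen_setOfPred_mapsTo hsphere isOpen_Ioi).preimage
      (continuous_representativeAt x), ?_, ?_⟩
  · intro z hz
    rw [Metric.mem_sphere, dist_comm] at hz
    rw [representativeAt_distClass, dist_self, sub_zero, hz]
    exact hr
  · intro y hy
    by_contra! hxy
    -- Error `r / 2` gives `d(z, y) - d(x, y) ≤ -r / 2`, against positivity on the sphere.
    obtain ⟨z, hz, hzy⟩ := hM x y r (r / 2) hr.le hxy (by positivity)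
    have hpos : 0 < representativeAt x (distClass y) z :=
      hy (by rw [Metric.mem_sphere, dist_comm, hz])
    rw [representativeAt_distClass, dist_comm y z, dist_comm y x] at hpos
    linarith

theorem HasApproxIntermediatePoints.isEmbedding_distClass [LocallyCompactSpace M]
    (hM : HasApproxIntermediatePoints M) :
    IsEmbedding (distClass : M → FunctionsModConst M) := by
  refine ⟨isInducing_iff_nhds.2 fun x => le_antisymm
    (continuous_distClass.tendsto x).le_comap ?_, injective_distClass⟩
  intro s hs
  obtain ⟨r, hr, hc⟩ := Metric.exists_isCompact_closedBall x
  obtain ⟨ε, hε, hs⟩ := Metric.mem_nhds_iff.1 hs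
  obtain ⟨U, hU, hxU, hsub⟩ := hM.exists_isOpen_distClass x (lt_min hr hε)
    (hc.of_isClosed_subset Metric.isClosed_closedBall
      (Metric.closedBall_subset_closedBall (min_le_left _ _)))
  refine ⟨U, hU.mem_nhds hxU, fun y hy => hs ?_⟩
  rw [Metric.mem_ball, dist_comm]
  exact (hsub y hy).trans_le (min_le_right _ _)

theorem HasApproxIntermediatePoints.exists_isOpen_inter_closure_subset [LocallyCompactSpace M]
    (hM : HasApproxIntermediatePoints M) (x : M) :
    ∃ U : Set (FunctionsModConst M), IsOpen U ∧ distClass x ∈ U ∧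
      U ∩ closure (range (distClass : M → FunctionsModConst M)) ⊆ range distClass := by
  have : Nonempty M := ⟨x⟩
  have := t2Space_functionsModConst (M := M)
  obtain ⟨r, hr, hc⟩ := Metric.exists_isCompact_closedBall x
  obtain ⟨U, hU, hxU, hsub⟩ := hM.exists_isOpen_distClass x hr hc
  -- As `U` is open, its limit classes are limits of classes `distClass y` in `U`; these `y` lie in
  -- a compact ball, whose image is closed.
  refine ⟨U, hU, hxU, hU.inter_closure.trans ?_⟩
  refine (closure_minimal (t := distClass '' Metric.closedBall x r) ?_
    (hc.image continuous_distClass).isClosed).trans (image_subset_range _ _)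
  rintro _ ⟨hyU, y, rfl⟩
  refine ⟨y, ?_, rfl⟩
  rw [Metric.mem_closedBall, dist_comm]
  exact (hsub y hyU).le

theorem HasApproxIntermediatePoints.isCompactification [LocallyCompactSpace M]
    [SigmaCompactSpace M] [Nonempty M] (hM : HasApproxIntermediatePoints M) :
    IsCompactification (toMetricCompactification : M → MetricCompactification M) where
  seqCompact := seqCompactSpace_metricCompactification
  hausdorff := by
    have := t2Space_functionsModConst (M := M)
    infer_instance
  isEmbedding := hM.isEmbedding_distClass.codRestrict _ _
  isOpen_range := by
    refine isOpen_iff_mem_nhds.2 ?_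
    rintro _ ⟨x, rfl⟩
    obtain ⟨U, hU, hxU, hsub⟩ := hM.exists_isOpen_inter_closure_subset x
    filter_upwards [(hU.preimage continuous_subtype_val).mem_nhds hxU] with ξ hξ
    obtain ⟨y, hy⟩ := hsub ⟨hξ, ξ.2⟩
    exact ⟨y, Subtype.ext hy⟩
  dense_range := by
    intro ξ
    rw [closure_subtype, ← range_comp]
    exact ξ.2

end MetricCompactification

/-! ### Geodesics of the Poincaré disc -/

theorem poincareDist_nonneg (z w : ℂ) : 0 ≤ poincareDist z w :=
  Real.artanh_nonneg (norm_nonneg _)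

theorem poincareDist_zero_left (w : ℂ) : poincareDist 0 w = Real.artanh ‖w‖ := by
  simp [poincareDist]

/-- The quotient is the subtraction formula for `tanh`. -/
theorem artanh_add_artanh_div {u s : ℝ} (hu : 0 ≤ u) (hus : u ≤ s) (hs : s < 1) :
    Real.artanh u + Real.artanh ((s - u) / (1 - u * s)) = Real.artanh s := by
  have hd : 0 < 1 - u * s := by nlinarith
  have hq0 : 0 ≤ (s - u) / (1 - u * s) := div_nonneg (by linarith) hd.le
  have hq1 : (s - u) / (1 - u * s) < 1 := by rw [div_lt_one hd]; nlinarith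
  rw [Real.artanh_eq_half_log ⟨by linarith, by linarith⟩,
    Real.artanh_eq_half_log ⟨by linarith, hq1.le⟩,
    Real.artanh_eq_half_log ⟨by linarith, hs.le⟩, ← mul_add, ← Real.log_mul]
  · congr 2
    have h1 : 1 + (s - u) / (1 - u * s) = (1 + s) * (1 - u) / (1 - u * s) := by
      rw [eq_div_iff hd.ne', add_mul, div_mul_cancel₀ _ hd.ne']; ring
    have h2 : 1 - (s - u) / (1 - u * s) = (1 - s) * (1 + u) / (1 - u * s) := by
      rw [eq_div_iff hd.ne', sub_mul, div_mul_cancel₀ _ hd.ne']; ring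
    have h3 : 1 - u ≠ 0 := by linarith
    have h4 : 1 - s ≠ 0 := by linarith
    have h5 : 1 + u ≠ 0 := by linarith
    rw [h1, h2]
    field_simp
  · exact (div_pos (by linarith) (by linarith)).ne'
  · exact (div_pos (by linarith) (by linarith)).ne'

theorem poincareDist_add_of_mem_segment {w : ℂ} (hw : ‖w‖ < 1) {t : ℝ} (ht : t ∈ Icc (0 : ℝ) 1) :
    poincareDist 0 (t * w) + poincareDist (t * w) w = poincareDist 0 w := by
  have hu : t * ‖w‖ ≤ ‖w‖ := mul_le_of_le_one_left (norm_nonneg _) ht.2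
  have hd : 0 < 1 - t * ‖w‖ * ‖w‖ := by nlinarith [norm_nonneg w, mul_nonneg ht.1 (norm_nonneg w)]
  have hden : (1 : ℂ) - conj w * (t * w) = ((1 - t * ‖w‖ * ‖w‖ : ℝ) : ℂ) := by
    have := Complex.conj_mul' w
    push_cast
    linear_combination -(t : ℂ) * this
  have hnum : (t : ℂ) * w - w = ((t - 1 : ℝ) : ℂ) * w := by push_cast; ring
  have hnorm : ‖((t : ℂ) * w - w) / (1 - conj w * (t * w))‖ =
      (‖w‖ - t * ‖w‖) / (1 - t * ‖w‖ * ‖w‖) := by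
    rw [hden, hnum, norm_div, norm_mul, Complex.norm_real, Complex.norm_real, Real.norm_eq_abs,
      Real.norm_eq_abs, abs_of_pos hd, abs_of_nonpos (by linarith [ht.2])]
    ring
  rw [poincareDist_zero_left, poincareDist_zero_left, poincareDist, hnorm, norm_mul,
    Complex.norm_real, Real.norm_of_nonneg ht.1]
  exact artanh_add_artanh_div (mul_nonneg ht.1 (norm_nonneg _)) hu hw

/-- The automorphism `ζ ↦ (ζ + a) / (1 + conj a * ζ)` of the unit disc. -/
noncomputable def discMobius (a ζ : ℂ) : ℂ := (ζ + a) / (1 + conj a * ζ)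

theorem one_add_conj_mul_ne_zero {a ζ : ℂ} (ha : ‖a‖ < 1) (hζ : ‖ζ‖ < 1) :
    1 + conj a * ζ ≠ 0 := by
  intro h
  have h1 : conj a * ζ = -1 := by linear_combination h
  have h2 : ‖a‖ * ‖ζ‖ = 1 := by simpa using congrArg norm h1
  nlinarith [norm_nonneg a, norm_nonneg ζ]

theorem norm_discMobius_lt_one {a ζ : ℂ} (ha : ‖a‖ < 1) (hζ : ‖ζ‖ < 1) :
    ‖discMobius a ζ‖ < 1 := by
  rw [discMobius, norm_div, div_lt_one (norm_pos_iff.2 (one_add_conj_mul_ne_zero ha hζ)),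
    ← sq_lt_sq₀ (norm_nonneg _) (norm_nonneg _), ← Complex.normSq_eq_norm_sq,
    ← Complex.normSq_eq_norm_sq]
  have ha' : Complex.normSq a < 1 := by
    rw [Complex.normSq_eq_norm_sq]; nlinarith [norm_nonneg a]
  have hζ' : Complex.normSq ζ < 1 := by
    rw [Complex.normSq_eq_norm_sq]; nlinarith [norm_nonneg ζ]
  simp only [Complex.normSq_apply, Complex.add_re, Complex.add_im, Complex.mul_re, Complex.mul_im,
    Complex.conj_re, Complex.conj_im, Complex.one_re, Complex.one_im] at *
  -- `|1 + conj a * ζ|² - |ζ + a|² = (1 - |a|²)(1 - |ζ|²)`.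
  nlinarith [mul_pos (sub_pos.2 ha') (sub_pos.2 hζ')]

theorem discMobius_zero (a : ℂ) : discMobius a 0 = a := by simp [discMobius]

theorem discMobius_discMobius_neg {a b : ℂ} (ha : ‖a‖ < 1) (hb : ‖b‖ < 1) :
    discMobius a (discMobius (-a) b) = b := by
  have h1 : 1 + conj (-a) * b ≠ 0 := one_add_conj_mul_ne_zero (by simpa using ha) hb
  have h3 := one_add_conj_mul_ne_zero ha (norm_discMobius_lt_one (a := -a) (by simpa using ha) hb)
  have h4 : discMobius (-a) b * (1 + conj (-a) * b) = b + -a := div_mul_cancel₀ _ h1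
  rw [discMobius, div_eq_iff h3]
  rw [map_neg] at h4
  linear_combination h4

theorem poincareDist_eq_artanh_discMobius (a b : ℂ) :
    poincareDist a b = Real.artanh ‖discMobius (-a) b‖ := by
  rw [poincareDist_comm, poincareDist, discMobius]
  simp [sub_eq_add_neg]

theorem differentiableOn_discMobius {a : ℂ} (ha : ‖a‖ < 1) :
    DifferentiableOn ℂ (discMobius a) (Metric.ball 0 1) := by
  refine DifferentiableOn.div (by fun_prop) (by fun_prop) fun ζ hζ => ?_
  exact one_add_conj_mul_ne_zero ha (by simpa using hζ)

/-! ### The Kobayashi distance is continuous and inner -/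

section Kobayashi

variable {E : Type*} [NormedAddCommGroup E] [NormedSpace ℂ E] {X : Type*}
  [TopologicalSpace X] [ChartedSpace E X]

theorem DiscChain.nonneg {x y : X} {L : ℝ} (h : DiscChain E x y L) : 0 ≤ L := by
  induction h with
  | nil => exact le_rfl
  | cons _ _ _ _ ih => exact add_nonneg (poincareDist_nonneg _ _) ih

theorem DiscChain.single {f : ℂ → X} (hf : IsHolomorphicDisc E f) {a b : ℂ} (ha : ‖a‖ < 1)
    (hb : ‖b‖ < 1) : DiscChain E (f a) (f b) (poincareDist a b) := by
  simpa using DiscChain.cons hf (by simpa using ha) (by simpa using hb) (DiscChain.nil (f b))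

theorem IsHolomorphicDisc.comp_discMobius {f : ℂ → X} (hf : IsHolomorphicDisc E f) {a : ℂ}
    (ha : ‖a‖ < 1) : IsHolomorphicDisc E (f ∘ discMobius a) :=
  MDifferentiableOn.comp hf (differentiableOn_discMobius ha).mdifferentiableOn fun ζ hζ => by
    simpa using norm_discMobius_lt_one ha (by simpa using hζ)

/-- The image of the Poincaré geodesic from `a` to `b` is connected, and each of its points splits
the disc into two chains of the same total length. -/
theorem IsHolomorphicDisc.exists_isPreconnected {f : ℂ → X} (hf : IsHolomorphicDisc E f)
    {a b : ℂ} (ha : ‖a‖ < 1) (hb : ‖b‖ < 1) :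
    ∃ S : Set X, IsPreconnected S ∧ f a ∈ S ∧ f b ∈ S ∧ ∀ p ∈ S, ∃ L₁ L₂,
      DiscChain E (f a) p L₁ ∧ DiscChain E p (f b) L₂ ∧ L₁ + L₂ = poincareDist a b := by
  set w := discMobius (-a) b with hw
  have hw1 : ‖w‖ < 1 := norm_discMobius_lt_one (by simpa using ha) hb
  have hg := hf.comp_discMobius ha
  have hga : (f ∘ discMobius a) 0 = f a := by simp [discMobius_zero]
  have hgb : (f ∘ discMobius a) w = f b := by
    simp only [Function.comp_apply, hw, discMobius_discMobius_neg ha hb]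
  have htw : ∀ t ∈ Icc (0 : ℝ) 1, ‖(t : ℂ) * w‖ < 1 := fun t ht => by
    rw [norm_mul, Complex.norm_real, Real.norm_of_nonneg ht.1]
    exact (mul_le_of_le_one_left (norm_nonneg _) ht.2).trans_lt hw1
  refine ⟨(fun t : ℝ => (f ∘ discMobius a) (t * w)) '' Icc 0 1, ?_, ⟨0, by simp, ?_⟩,
    ⟨1, by simp, ?_⟩, ?_⟩
  · refine isPreconnected_Icc.image _ (hg.continuousOn.comp (by fun_prop) fun t ht => ?_)
    simpa using htw t ht
  · simpa using hga
  · simpa using hgb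
  · rintro _ ⟨t, ht, rfl⟩
    have h1 := DiscChain.single hg (a := 0) (b := t * w) (by simp) (htw t ht)
    have h2 := DiscChain.single hg (htw t ht) hw1
    rw [hga] at h1
    rw [hgb] at h2
    refine ⟨_, _, h1, h2, ?_⟩
    rw [poincareDist_add_of_mem_segment hw1 ht, poincareDist_zero_left,
      poincareDist_eq_artanh_discMobius]

theorem DiscChain.exists_isPreconnected {x y : X} {L : ℝ} (h : DiscChain E x y L) :
    ∃ S : Set X, IsPreconnected S ∧ x ∈ S ∧ y ∈ S ∧ ∀ p ∈ S, ∃ L₁ L₂,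
      DiscChain E x p L₁ ∧ DiscChain E p y L₂ ∧ L₁ + L₂ = L := by
  induction h with
  | nil x =>
    refine ⟨{x}, isPreconnected_singleton, rfl, rfl, ?_⟩
    rintro _ rfl
    exact ⟨0, 0, .nil _, .nil _, add_zero 0⟩
  | @cons f a b y L hf ha hb h ih =>
    rw [mem_ball_zero_iff] at ha hb
    obtain ⟨S, hS, haS, hbS, hSp⟩ := hf.exists_isPreconnected ha hb
    obtain ⟨T, hT, hbT, hyT, hTp⟩ := ih
    refine ⟨S ∪ T, hS.union (f b) hbS hbT hT, Or.inl haS, Or.inr hyT, ?_⟩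
    rintro p (hp | hp)
    · obtain ⟨L₁, L₂, h₁, h₂, hsum⟩ := hSp p hp
      exact ⟨L₁, L₂ + L, h₁, h₂.append h, by rw [← hsum]; ring⟩
    · obtain ⟨L₁, L₂, h₁, h₂, hsum⟩ := hTp p hp
      exact ⟨_, L₂, (DiscChain.single hf ha hb).append h₁, h₂, by rw [← hsum]; ring⟩

theorem exists_discChain_lt {x y : X} {c : ℝ≥0∞} (h : kobayashiEDist E x y < c) :
    ∃ L, DiscChain E x y L ∧ ENNReal.ofReal L < c := by
  simpa [kobayashiEDist, iInf_lt_iff] using h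

variable [IsManifold 𝓘(ℂ, E) ω X]

/-- A single affine disc in a chart takes `0` to `x` and `s` to `y`; it stays in the chart's ball of
radius `r` when `y` is within `s * r` of `x`. -/
theorem eventually_discChain_artanh (x : X) {s : ℝ} (hs : 0 < s) (hs1 : s < 1) :
    ∀ᶠ y in 𝓝 x, DiscChain E x y (Real.artanh s) := by
  set φ := chartAt E x with hφ
  obtain ⟨r, hr, hball⟩ := Metric.isOpen_iff.1 φ.open_target (φ x)
    (φ.map_source (mem_chart_source E x))
  have hnear : ∀ᶠ y in 𝓝 x, φ y ∈ Metric.ball (φ x) (s * r) :=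
    (φ.continuousAt (mem_chart_source E x)).eventually (Metric.ball_mem_nhds _ (by positivity))
  filter_upwards [hnear, chart_source_mem_nhds E x] with y hy hys
  set v : E := φ y - φ x with hv
  have hvr : ‖v‖ < s * r := by simpa [hv, dist_eq_norm] using hy
  have hs0 : (s : ℂ) ≠ 0 := by exact_mod_cast hs.ne'
  set g : ℂ → E := fun ζ => φ x + (ζ / s) • v with hg
  have hmaps : MapsTo g (Metric.ball 0 1) φ.target := by
    intro ζ hζ
    apply hball
    have hζ' : ‖ζ‖ < 1 := by simpa using hζ
    have : ‖ζ‖ / s * ‖v‖ < r := by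
      rw [div_mul_eq_mul_div, div_lt_iff₀ hs]
      nlinarith [norm_nonneg ζ, norm_nonneg v]
    simpa [hg, dist_eq_norm, norm_smul, abs_of_pos hs] using this
  have hgd : MDifferentiableOn 𝓘(ℂ, ℂ) 𝓘(ℂ, E) g (Metric.ball 0 1) := by
    have : Differentiable ℂ g := by simp only [hg]; fun_prop
    exact this.mdifferentiable.mdifferentiableOn
  have hsymm : MDifferentiableOn 𝓘(ℂ, E) 𝓘(ℂ, E) φ.symm φ.target :=
    (contMDiffOn_chart_symm (I := 𝓘(ℂ, E)) (n := ω) (x := x)).mdifferentiableOn (by simp)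
  have hdisc : IsHolomorphicDisc E (φ.symm ∘ g) := hsymm.comp hgd hmaps
  have h0 : (φ.symm ∘ g) 0 = x := by
    simp [hg, φ.left_inv (mem_chart_source E x)]
  have h1 : (φ.symm ∘ g) s = y := by
    simp [hg, hv, hs0, φ.left_inv hys]
  have hchain := DiscChain.single hdisc (a := 0) (b := s) (by simp) (by simpa [abs_of_pos hs])
  rwa [h0, h1, poincareDist_zero_left, Complex.norm_real, Real.norm_of_nonneg hs.le] at hchain

variable [ConnectedSpace X] [KobayashiHyperbolic E X]

theorem dist_toKobayashiSpace_le {x y : X} {L : ℝ} (h : DiscChain E x y L) :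
    dist (toKobayashiSpace E x) (toKobayashiSpace E y) ≤ L :=
  ENNReal.toReal_le_of_le_ofReal h.nonneg (iInf₂_le L h)

theorem exists_discChain_of_dist_lt {x y : X} {c : ℝ}
    (h : dist (toKobayashiSpace E x) (toKobayashiSpace E y) < c) :
    ∃ L < c, DiscChain E x y L := by
  have hc : 0 < c := dist_nonneg.trans_lt h
  have h' : kobayashiEDist E x y < ENNReal.ofReal c :=
    (ENNReal.lt_ofReal_iff_toReal_lt (kobayashiEDist_ne_top x y)).2 h
  obtain ⟨L, hL, hlt⟩ := exists_discChain_lt h'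
  exact ⟨L, (ENNReal.ofReal_lt_ofReal_iff hc).1 hlt, hL⟩

theorem continuous_toKobayashiSpace : Continuous (toKobayashiSpace E : X → KobayashiSpace E X) := by
  refine continuous_iff_continuousAt.2 fun x => Metric.tendsto_nhds.2 fun ε hε => ?_
  have hpos : 0 < Real.tanh (ε / 2) := by
    rw [Real.tanh_eq_sinh_div_cosh]
    exact div_pos (Real.sinh_pos_iff.2 (by positivity)) (Real.cosh_pos _)
  filter_upwards [eventually_discChain_artanh (E := E) x hpos (Real.tanh_lt_one _)] with y hy
  rw [Real.artanh_tanh] at hy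
  rw [dist_comm]
  exact (dist_toKobayashiSpace_le hy).trans_lt (by linarith)

/-- Take `δ` to be the minimal distance from `x` to the frontier of a relatively compact
neighbourhood: a chain leaving it has a point there, so its length is at least `δ`. -/
theorem exists_dist_toKobayashiSpace_lt_imp_mem [LocallyCompactSpace X] [T2Space X] {x : X}
    {U : Set X} (hU : U ∈ 𝓝 x) :
    ∃ δ > 0, ∀ y, dist (toKobayashiSpace E x) (toKobayashiSpace E y) < δ → y ∈ U := by
  obtain ⟨K, hK, hKU, hKc⟩ := local_compact_nhds hU
  have hxV : x ∈ interior K := mem_interior_iff_mem_nhds.2 hK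
  have hfc : IsCompact (frontier (interior K)) :=
    hKc.of_isClosed_subset isClosed_frontier (frontier_subset_closure.trans
      (closure_minimal interior_subset hKc.isClosed))
  have hcont : Continuous fun y => dist (toKobayashiSpace E x) (toKobayashiSpace E y) :=
    continuous_const.dist continuous_toKobayashiSpace
  obtain ⟨δ, hδ, hmin⟩ : ∃ δ > 0, ∀ p ∈ frontier (interior K),
      δ ≤ dist (toKobayashiSpace E x) (toKobayashiSpace E p) := by
    rcases (frontier (interior K)).eq_empty_or_nonempty with hemp | hne
    · exact ⟨1, one_pos, by simp [hemp]⟩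
    · obtain ⟨q, hq, hqmin⟩ := hfc.exists_isMinOn hne hcont.continuousOn
      -- Hyperbolicity enters here: the minimum is positive because `q ≠ x`.
      refine ⟨_, dist_pos.2 fun hxq => ?_, fun p hp => hqmin hp⟩
      have hxq' : x = q := hxq
      rw [isOpen_interior.frontier_eq, ← hxq'] at hq
      exact hq.2 hxV
  refine ⟨δ, hδ, fun y hy => hKU ?_⟩
  by_contra hyK
  obtain ⟨L, hLδ, hL⟩ := exists_discChain_of_dist_lt hy
  obtain ⟨S, hS, hxS, hyS, hSp⟩ := hL.exists_isPreconnected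
  obtain ⟨p, hpS, hpf⟩ := hS.inter_frontier_nonempty_of_isOpen isOpen_interior hxS hxV hyS
    fun h => hyK (interior_subset h)
  obtain ⟨L₁, L₂, h₁, h₂, hsum⟩ := hSp p hpS
  linarith [hmin p hpf, dist_toKobayashiSpace_le h₁, h₂.nonneg]

theorem isHomeomorph_toKobayashiSpace [LocallyCompactSpace X] [T2Space X] :
    IsHomeomorph (toKobayashiSpace E : X → KobayashiSpace E X) where
  continuous := continuous_toKobayashiSpace
  isOpenMap := by
    refine fun U hU => Metric.isOpen_iff.2 ?_
    rintro _ ⟨x, hx, rfl⟩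
    obtain ⟨δ, hδ, h⟩ := exists_dist_toKobayashiSpace_lt_imp_mem (E := E) (hU.mem_nhds hx)
    refine ⟨δ, hδ, fun y hy => ⟨y, h y ?_, rfl⟩⟩
    rw [dist_comm]
    exact hy
  bijective := Function.bijective_id

theorem exists_dist_toKobayashiSpace_eq (x y : X) {r ε : ℝ} (hr : 0 ≤ r)
    (hrxy : r ≤ dist (toKobayashiSpace E x) (toKobayashiSpace E y)) (hε : 0 < ε) :
    ∃ z : X, dist (toKobayashiSpace E x) (toKobayashiSpace E z) = r ∧
      dist (toKobayashiSpace E x) (toKobayashiSpace E z) +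
        dist (toKobayashiSpace E z) (toKobayashiSpace E y) ≤
          dist (toKobayashiSpace E x) (toKobayashiSpace E y) + ε := by
  obtain ⟨L, hLlt, hL⟩ := exists_discChain_of_dist_lt
    (lt_add_of_pos_right (dist (toKobayashiSpace E x) (toKobayashiSpace E y)) hε)
  obtain ⟨S, hS, hxS, hyS, hSp⟩ := hL.exists_isPreconnected
  have hcont : Continuous fun p : X => dist (toKobayashiSpace E x) (toKobayashiSpace E p) :=
    continuous_const.dist continuous_toKobayashiSpace
  obtain ⟨z, hzS, hz⟩ := hS.intermediate_value hxS hyS hcont.continuousOn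
    ⟨by rwa [dist_self], hrxy⟩
  obtain ⟨L₁, L₂, h₁, h₂, hsum⟩ := hSp z hzS
  refine ⟨z, hz, ?_⟩
  linarith [dist_toKobayashiSpace_le h₁, dist_toKobayashiSpace_le h₂]

theorem hasApproxIntermediatePoints_kobayashiSpace :
    HasApproxIntermediatePoints (KobayashiSpace E X) := fun x y _ _ hr hrxy hε =>
  let ⟨z, hz⟩ := exists_dist_toKobayashiSpace_eq (E := E) (X := X) x y hr hrxy hε
  ⟨toKobayashiSpace E z, hz⟩

end Kobayashi

theorem theorem1p1 {E : Type*} [NormedAddCommGroup E] [NormedSpace ℂ E] [FiniteDimensional ℂ E]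
    {X : Type*} [TopologicalSpace X] [ChartedSpace E X] [IsManifold 𝓘(ℂ, E) ω X]
    [T2Space X] [SecondCountableTopology X] [ConnectedSpace X] [KobayashiHyperbolic E X] :
    IsHomeomorph (toKobayashiSpace E : X → KobayashiSpace E X) ∧
      IsCompactification
        (toMetricCompactification : KobayashiSpace E X →
          MetricCompactification (KobayashiSpace E X)) := by
  have : LocallyCompactSpace X := Manifold.locallyCompact_of_finiteDimensional 𝓘(ℂ, E)
  have hhomeo := isHomeomorph_toKobayashiSpace (E := E) (X := X)
  let e : X ≃ₜ KobayashiSpace E X := hhomeo.homeomorph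
  have : LocallyCompactSpace (KobayashiSpace E X) :=
    e.symm.isClosedEmbedding.locallyCompactSpace
  have : SigmaCompactSpace (KobayashiSpace E X) := e.symm.isClosedEmbedding.sigmaCompactSpace
  have : Nonempty (KobayashiSpace E X) := (inferInstance : Nonempty X)
  exact ⟨hhomeo, hasApproxIntermediatePoints_kobayashiSpace.isCompactification⟩
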